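/- Let $n \ge 141$ be an integer. All graphs are finite and simple; for a graph $G$, let $c(G)$ denote the number of cycles in $G$, that is, the number of subgraphs of $G$ that are cycles (of any length at least $3$). The balanced complete bipartite graph $K_{\lceil n/2\rceil,\lfloor n/2\rfloor}$ is a triangle-free graph on $n$ vertices, and every triangle-free graph $G$ on $n$ vertices satisfies $$c(G) \le c\bigl(K_{\lceil n/2\rceil,\lfloor n/2\rfloor}\bigr),$$ with equality only if $G$ is isomorphic to $K_{\lceil n/2\rceil,\lfloor n/2\rfloor}$. -/

import Mathlib

/-- The cycles of `G`, as subgraphs of `G`: a cycle is counted once, whatever its starting vertex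
and orientation. (In Mathlib, a walk satisfying `IsCycle` has length at least three.) -/
def SimpleGraph.cycleSubgraphs {V : Type*} (G : SimpleGraph V) : Set G.Subgraph :=
  {H | ∃ (v : V) (p : G.Walk v v), p.IsCycle ∧ p.toSubgraph = H}

/-- The number of cycles of `G`. It is used for finite graphs only, for which the set of cycles
is finite. -/
noncomputable def SimpleGraph.numCycles {V : Type*} (G : SimpleGraph V) : ℕ :=
  G.cycleSubgraphs.ncard

/-- The balanced complete bipartite graph on `n` vertices. -/
abbrev balancedCompleteBipartite (n : ℕ) : SimpleGraph (Fin ((n + 1) / 2) ⊕ Fin (n / 2)) :=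
  completeBipartiteGraph (Fin ((n + 1) / 2)) (Fin (n / 2))

/-! A bipartite `G` lies in a complete bipartite graph. Among those on `n` vertices the balanced one
has strictly the most cycles (`bipCycles_lt`), and every missing edge costs a 4-cycle
(`IsCompleteBip.numCycles_lt`).

If `G` is not bipartite, the Andrásfai–Erdős–Sós theorem gives a vertex `v` of degree `d ≤ 2n/5`.
Cycles through `v` correspond to paths avoiding `v` between two neighbors of `v`
(`two_mul_numCyclesIn`). The ends of an edge have disjoint neighborhoods, so two consecutive steps
of a path offer about `(m/2)²` choices among `m` vertices; this gives `hasPathBound`. Cycles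
avoiding `v` are fewer by a factor of order `n` (`numCyclesIn_le`).

In the balanced graph a vertex has about `n/2` neighbors, so the pairs of neighbors lose a factor of
about 16/25. For even `n` the path bound is exact. For odd `n` it overshoots by about 2.341/1.59,
and still `16/25 · 2.341 < 1.59`. The margin absorbs the cycles avoiding `v` once `n ≥ 141`. -/

namespace SimpleGraph

/-! ### Recursions for paths and for cycles based at a vertex -/

variable {V : Type*} (G : SimpleGraph V)

/-- The paths of `G` from `x` to `z` all of whose vertices lie in `W`. -/
def pathsIn (W : Finset V) (x z : V) : Set (G.Walk x z) :=
  {q | q.IsPath ∧ ∀ u ∈ q.support, u ∈ W}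

/-- The number of paths of `G` from `x` to `z` all of whose vertices lie in `W`. -/
noncomputable def numPathsIn (W : Finset V) (x z : V) : ℕ := Nat.card (G.pathsIn W x z)

/-- The cycles of `G`, as subgraphs, all of whose vertices lie in `W`. -/
def cyclesIn (W : Finset V) : Set G.Subgraph := {H | H ∈ G.cycleSubgraphs ∧ H.verts ⊆ W}

/-- The number of cycles of `G` all of whose vertices lie in `W`. -/
noncomputable def numCyclesIn (W : Finset V) : ℕ := (G.cyclesIn W).ncard

open Classical in
/-- The neighbors of `v` that lie in `W`. -/
noncomputable def nbrsIn (W : Finset V) (v : V) : Finset V := W.filter (G.Adj v)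

/-- The cycles of `G` based at `v`, as closed walks, all of whose vertices lie in `W`. -/
def cycleWalksIn (W : Finset V) (v : V) : Set (G.Walk v v) :=
  {p | p.IsCycle ∧ ∀ u ∈ p.support, u ∈ W}

variable {G}

@[simp] lemma mem_nbrsIn {W : Finset V} {v w : V} : w ∈ G.nbrsIn W v ↔ w ∈ W ∧ G.Adj v w := by
  simp [nbrsIn]

lemma numCyclesIn_univ [Fintype V] : G.numCyclesIn Finset.univ = G.numCycles := by
  simp [numCyclesIn, cyclesIn, numCycles]

instance finite_pathsIn [Finite V] (W : Finset V) (x z : V) : Finite (G.pathsIn W x z) := by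
  classical
  have := Fintype.ofFinite V
  have : Finite (G.Path x z) := Finite.of_fintype _
  exact Finite.of_injective (fun q : G.pathsIn W x z => (⟨q.1, q.2.1⟩ : G.Path x z))
    fun a b h => Subtype.ext (by simpa using h)

lemma numPathsIn_self (W : Finset V) {x : V} (hx : x ∈ W) : G.numPathsIn W x x = 1 := by
  rw [numPathsIn, Nat.card_eq_one_iff_unique]
  refine ⟨⟨fun a b => Subtype.ext ?_⟩, ⟨⟨Walk.nil, by simp [pathsIn, hx]⟩⟩⟩
  rw [(Walk.isPath_iff_nil.1 a.2.1).eq_nil, (Walk.isPath_iff_nil.1 b.2.1).eq_nil]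

lemma isCycle_cons_concat {v y z : V} (hy : G.Adj v y) (hz : G.Adj z v) (q : G.Walk y z)
    (hv : v ∉ q.support) (hq : q.IsPath) (hyz : y ≠ z) :
    (Walk.cons hy (q.concat hz)).IsCycle := by
  rw [Walk.cons_isCycle_iff, Walk.concat_isPath_iff]
  refine ⟨⟨hq, hv⟩, ?_⟩
  rw [Walk.edges_concat, List.concat_eq_append, List.mem_append, not_or]
  refine ⟨fun h => hv (q.fst_mem_support_of_mem_edges h), ?_⟩
  simp only [List.mem_singleton, Sym2.eq_iff, not_or, not_and]
  exact ⟨fun _ h => hy.ne h.symm, fun _ => hyz⟩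

variable [DecidableEq V]

lemma numPathsIn_of_ne [Finite V] {W : Finset V} {x z : V} (hx : x ∈ W) (hxz : x ≠ z) :
    G.numPathsIn W x z = ∑ y ∈ G.nbrsIn (W.erase x) x, G.numPathsIn (W.erase x) y z := by
  have key : (Σ y : G.nbrsIn (W.erase x) x, G.pathsIn (W.erase x) y z) ≃ G.pathsIn W x z := by
    refine Equiv.ofBijective
      (fun q => ⟨Walk.cons (mem_nbrsIn.1 q.1.2).2 q.2.1, ?_, ?_⟩) ⟨?_, ?_⟩
    · rw [Walk.cons_isPath_iff]
      exact ⟨q.2.2.1, fun h => by simpa using q.2.2.2 _ h⟩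
    · intro u hu
      rcases List.mem_cons.1 hu with rfl | hu
      · exact hx
      · exact Finset.mem_of_mem_erase (q.2.2.2 _ hu)
    · rintro ⟨⟨y, hy⟩, ⟨q, hq⟩⟩ ⟨⟨y', hy'⟩, ⟨q', hq'⟩⟩ h
      obtain ⟨h1, h2⟩ := Walk.cons.inj (congrArg Subtype.val h)
      dsimp only at h1
      subst h1
      obtain rfl := eq_of_heq h2
      rfl
    · rintro ⟨q, hq, hW⟩
      cases q with
      | nil => exact absurd rfl hxz
      | cons h q =>
        rename_i y
        rw [Walk.cons_isPath_iff] at hq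
        have hq' : ∀ u ∈ q.support, u ∈ W.erase x := fun u hu =>
          Finset.mem_erase.2 ⟨by rintro rfl; exact hq.2 hu, hW u (List.mem_cons_of_mem _ hu)⟩
        exact ⟨⟨⟨y, mem_nbrsIn.2 ⟨hq' _ q.start_mem_support, h⟩⟩, ⟨q, hq.1, hq'⟩⟩, rfl⟩
  rw [numPathsIn, ← Nat.card_congr key, Nat.card_sigma]
  exact Finset.sum_coe_sort (G.nbrsIn (W.erase x) x) fun y => G.numPathsIn (W.erase x) y z

/-- Removing the first and last edges of a cycle at `v` leaves a path between two distinct neighbors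
of `v`. The pairs are ordered because closed walks carry an orientation. -/
lemma card_cycleWalksIn [Finite V] {W : Finset V} {v : V} (hv : v ∈ W) :
    Nat.card (G.cycleWalksIn W v) = ∑ y ∈ G.nbrsIn (W.erase v) v,
      ∑ z ∈ (G.nbrsIn (W.erase v) v).erase y, G.numPathsIn (W.erase v) y z := by
  have key : (Σ y : G.nbrsIn (W.erase v) v, Σ z : (G.nbrsIn (W.erase v) v).erase y,
      G.pathsIn (W.erase v) y z) ≃ G.cycleWalksIn W v := by
    refine Equiv.ofBijective
      (fun q => ⟨Walk.cons (mem_nbrsIn.1 q.1.2).2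
        (q.2.2.1.concat (mem_nbrsIn.1 (Finset.mem_of_mem_erase q.2.1.2)).2.symm), ?_, ?_⟩) ⟨?_, ?_⟩
    · refine isCycle_cons_concat _ _ _ (fun h => ?_) q.2.2.2.1 (Finset.ne_of_mem_erase q.2.1.2).symm
      simpa using q.2.2.2.2 _ h
    · intro u hu
      rw [Walk.support_cons, Walk.support_concat] at hu
      simp only [List.mem_cons, List.mem_append, List.not_mem_nil, or_false] at hu
      rcases hu with rfl | hu | rfl
      · exact hv
      · exact Finset.mem_of_mem_erase (q.2.2.2.2 _ hu)
      · exact hv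
    · rintro ⟨⟨y, hy⟩, ⟨z, hz⟩, ⟨q, hq⟩⟩ ⟨⟨y', hy'⟩, ⟨z', hz'⟩, ⟨q', hq'⟩⟩ h
      obtain ⟨h1, h2⟩ := Walk.cons.inj (congrArg Subtype.val h)
      dsimp only at h1
      subst h1
      obtain ⟨h3, h4⟩ := Walk.concat_inj (eq_of_heq h2)
      dsimp only at h3
      subst h3
      rw [Walk.copy_rfl_rfl] at h4
      subst h4
      rfl
    · rintro ⟨p, hp, hW⟩
      cases p with
      | nil => exact absurd hp Walk.not_isCycle_nil
      | cons h r =>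
        rename_i y
        obtain ⟨z, q, h', rfl⟩ : ∃ (z : V) (q : G.Walk y z) (h' : G.Adj z v), r = q.concat h' :=
          ⟨_, r.dropLast, r.adj_penultimate (Walk.not_nil_of_isCycle_cons hp),
            (r.concat_dropLast _).symm⟩
        rw [Walk.cons_isCycle_iff, Walk.concat_isPath_iff] at hp
        obtain ⟨⟨hq, hvq⟩, hne⟩ := hp
        have hq' : ∀ u ∈ q.support, u ∈ W.erase v := fun u hu =>
          Finset.mem_erase.2 ⟨by rintro rfl; exact hvq hu, hW u (by
            simp [Walk.support_concat, hu])⟩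
        have hyz : z ≠ y := by
          rintro rfl
          apply hne
          simp [Walk.edges_concat, Sym2.eq_swap]
        exact ⟨⟨⟨y, mem_nbrsIn.2 ⟨hq' _ q.start_mem_support, h⟩⟩,
          ⟨z, Finset.mem_erase.2 ⟨hyz, mem_nbrsIn.2 ⟨hq' _ q.end_mem_support, h'.symm⟩⟩⟩,
          ⟨q, hq, hq'⟩⟩, rfl⟩
  have : ∀ y : G.nbrsIn (W.erase v) v,
      Finite (Σ z : (G.nbrsIn (W.erase v) v).erase y, G.pathsIn (W.erase v) y z) := fun y =>
    inferInstance
  rw [← Nat.card_congr key, Nat.card_sigma]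
  rw [← Finset.sum_coe_sort (G.nbrsIn (W.erase v) v)]
  refine Finset.sum_congr rfl fun y _ => ?_
  rw [Nat.card_sigma, ← Finset.sum_coe_sort ((G.nbrsIn (W.erase v) v).erase y)]
  rfl

lemma finite_cycleWalksIn [Finite V] (W : Finset V) (v : V) : (G.cycleWalksIn W v).Finite := by
  have := Fintype.ofFinite V
  classical
  refine (Set.Finite.subset (s := {p : G.Walk v v | p.length < Fintype.card V + 2}) ?_ ?_)
  · exact Set.toFinite _
  · rintro p ⟨hp, -⟩
    have h1 := hp.isPath_tail.length_lt
    have h2 := Walk.length_tail_add_one hp.not_nil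
    simp only [Set.mem_ofPred_eq]
    omega

end SimpleGraph

/-! ### From closed walks to cycle subgraphs -/

namespace SimpleGraph

variable {V : Type*} {G : SimpleGraph V}

/-- A path never returns to its start, so the start lies on exactly one of its edges, and the edge
set determines the next vertex. -/
lemma Walk.IsPath.eq_of_edges_mem_iff {x z : V} {p q : G.Walk x z} (hp : p.IsPath) (hq : q.IsPath)
    (h : ∀ e, e ∈ p.edges ↔ e ∈ q.edges) : p = q := by
  induction p with
  | nil => exact (Walk.isPath_iff_nil.1 hq).eq_nil.symm
  | @cons x y z hxy p ih =>
    cases q with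
    | nil => simpa using (h s(x, y)).1 (by simp)
    | @cons _ y' _ hxy' q =>
      rw [Walk.cons_isPath_iff] at hp hq
      have hpe : ∀ w, s(x, w) ∉ p.edges := fun w hw => hp.2 (p.fst_mem_support_of_mem_edges hw)
      have hqe : ∀ w, s(x, w) ∉ q.edges := fun w hw => hq.2 (q.fst_mem_support_of_mem_edges hw)
      have hy : y = y' := by
        have h1 := (h s(x, y)).1 (by simp)
        rw [Walk.edges_cons, List.mem_cons] at h1
        rcases h1 with h1 | h1
        · exact Sym2.congr_right.1 h1
        · exact absurd h1 (hqe y)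
      subst hy
      congr 1
      refine ih hp.1 hq.1 fun e => ?_
      have h2 := h e
      rw [Walk.edges_cons, Walk.edges_cons, List.mem_cons, List.mem_cons] at h2
      constructor
      · intro he
        rcases h2.1 (Or.inr he) with rfl | h3
        · exact absurd he (hpe y)
        · exact h3
      · intro he
        rcases h2.2 (Or.inr he) with rfl | h3
        · exact absurd he (hqe y)
        · exact h3

lemma Walk.IsCycle.eq_of_toSubgraph_eq {v : V} {p q : G.Walk v v} (hp : p.IsCycle) (hq : q.IsCycle)
    (h : p.toSubgraph = q.toSubgraph) (hs : p.snd = q.snd) : p = q := by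
  have he : ∀ e, e ∈ p.edges ↔ e ∈ q.edges := fun e => by
    rw [← Walk.mem_edges_toSubgraph, ← Walk.mem_edges_toSubgraph, h]
  cases p with
  | nil => exact absurd hp Walk.not_isCycle_nil
  | @cons _ y _ hy p =>
    cases q with
    | nil => exact absurd hq Walk.not_isCycle_nil
    | @cons _ y' _ hy' q =>
      simp only [Walk.snd_cons] at hs
      subst hs
      rw [Walk.cons_isCycle_iff] at hp hq
      congr 1
      refine hp.1.eq_of_edges_mem_iff hq.1 fun e => ?_
      have h2 := he e
      rw [Walk.edges_cons, Walk.edges_cons, List.mem_cons, List.mem_cons] at h2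
      constructor
      · intro he
        rcases h2.1 (Or.inr he) with rfl | h3
        · exact absurd he hp.2
        · exact h3
      · intro he
        rcases h2.2 (Or.inr he) with rfl | h3
        · exact absurd he hq.2
        · exact h3

/-- In the cycle, `v` has only two neighbors, and the choice of the first step fixes the traversal.
-/
lemma Walk.IsCycle.eq_or_eq_reverse {v : V} {p q : G.Walk v v} (hp : p.IsCycle) (hq : q.IsCycle)
    (h : q.toSubgraph = p.toSubgraph) : q = p ∨ q = p.reverse := by
  have h1 : q.snd ∈ p.toSubgraph.neighborSet v := by
    rw [← h]
    exact q.toSubgraph_adj_snd hq.not_nil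
  rw [hp.neighborSet_toSubgraph_endpoint] at h1
  rcases h1 with h1 | h1
  · exact Or.inl (hq.eq_of_toSubgraph_eq hp h h1)
  · refine Or.inr (hq.eq_of_toSubgraph_eq hp.reverse (h.trans p.toSubgraph_reverse.symm) ?_)
    rw [Walk.snd_reverse]
    exact h1

lemma Walk.IsCycle.ne_reverse {v : V} {p : G.Walk v v} (hp : p.IsCycle) : p ≠ p.reverse := by
  intro h
  apply hp.snd_ne_penultimate
  conv_lhs => rw [h]
  rw [Walk.snd_reverse]

variable [DecidableEq V]

instance finite_subgraph [Finite V] : Finite G.Subgraph := by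
  refine Finite.of_injective
    (fun H : G.Subgraph => (H.verts, fun u v => H.Adj u v)) fun H K h => ?_
  rw [Prod.mk.injEq] at h
  exact Subgraph.ext h.1 h.2

lemma card_cycleWalksIn_eq_two_mul [Finite V] (W : Finset V) (v : V) :
    Nat.card (G.cycleWalksIn W v) = 2 * {H | H ∈ G.cyclesIn W ∧ v ∈ H.verts}.ncard := by
  classical
  have hfin := finite_cycleWalksIn (G := G) W v
  have hfin' := Set.toFinite {H | H ∈ G.cyclesIn W ∧ v ∈ H.verts}
  rw [Nat.card_coe_set_eq, Set.ncard_eq_toFinset_card _ hfin, Set.ncard_eq_toFinset_card _ hfin']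
  rw [Finset.card_eq_sum_card_fiberwise (f := fun p => p.toSubgraph) (t := hfin'.toFinset)]
  · rw [mul_comm, ← smul_eq_mul, ← Finset.sum_const]
    refine Finset.sum_congr rfl fun H hH => ?_
    obtain ⟨⟨⟨w, p, hp, rfl⟩, hW⟩, hv⟩ := (Set.Finite.mem_toFinset _).1 hH
    rw [Walk.mem_verts_toSubgraph] at hv
    have hp0 := hp.rotate hv
    have hsub := p.toSubgraph_rotate hv
    rw [← hsub] at hW ⊢
    generalize p.rotate v hv = p0 at hp0 hW
    rw [← Finset.card_pair hp0.ne_reverse]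
    congr 1
    ext q
    simp only [Finset.mem_filter, Set.Finite.mem_toFinset, Finset.mem_insert,
      Finset.mem_singleton]
    constructor
    · rintro ⟨hq, h⟩
      exact hp0.eq_or_eq_reverse hq.1 h
    · have hW' : ∀ u ∈ p0.support, u ∈ W := fun u hu => hW (p0.mem_verts_toSubgraph.2 hu)
      rintro (rfl | rfl)
      · exact ⟨⟨hp0, hW'⟩, rfl⟩
      · refine ⟨⟨hp0.reverse, fun u hu => hW' u ?_⟩, p0.toSubgraph_reverse⟩
        simpa using hu
  · intro p hp
    have hp := (Set.Finite.mem_toFinset _).1 hp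
    refine (Set.Finite.mem_toFinset _).2 ⟨⟨⟨v, p, hp.1, rfl⟩, fun u hu => ?_⟩, ?_⟩
    · exact hp.2 u (p.mem_verts_toSubgraph.1 hu)
    · exact p.start_mem_verts_toSubgraph

/-- Removing a vertex `v`: the cycles through `v` correspond, two to one, to the paths avoiding `v`
between two distinct neighbors of `v`. -/
theorem two_mul_numCyclesIn [Finite V] {W : Finset V} {v : V} (hv : v ∈ W) :
    2 * G.numCyclesIn W = 2 * G.numCyclesIn (W.erase v) + ∑ y ∈ G.nbrsIn (W.erase v) v,
      ∑ z ∈ (G.nbrsIn (W.erase v) v).erase y, G.numPathsIn (W.erase v) y z := by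
  rw [← card_cycleWalksIn hv, card_cycleWalksIn_eq_two_mul, ← mul_add]
  congr 1
  rw [numCyclesIn, numCyclesIn, ← Set.ncard_union_eq _ (Set.toFinite _) (Set.toFinite _)]
  · congr 1
    ext H
    simp only [cyclesIn, Set.mem_union, Set.mem_ofPred_eq, Finset.coe_erase, Set.subset_sdiff,
      Set.disjoint_singleton_right]
    tauto
  · rw [Set.disjoint_left]
    rintro H ⟨_, h⟩ ⟨_, hv⟩
    simpa using h hv

omit [DecidableEq V] in
lemma numCyclesIn_empty [Finite V] : G.numCyclesIn ∅ = 0 := by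
  rw [numCyclesIn, Set.ncard_eq_zero (Set.toFinite _), Set.eq_empty_iff_forall_notMem]
  rintro H ⟨⟨v, p, -, rfl⟩, h⟩
  simpa using h p.start_mem_verts_toSubgraph

end SimpleGraph

/-! ### Upper bound for paths in triangle-free graphs -/

namespace SimpleGraph

variable {V : Type*} {G : SimpleGraph V}

lemma CliqueFree.not_adj_of_adj_of_adj {x y z : V} (hG : G.CliqueFree 3) (hxy : G.Adj x y)
    (hyz : G.Adj y z) : ¬ G.Adj x z := fun hxz => by
  classical
  exact hG {x, y, z} (is3Clique_triple_iff.2 ⟨hxy, hxz, hyz⟩)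

/-- An upper bound for the number of paths between two given vertices in a triangle-free graph with
`m` further vertices. -/
def pathBound : ℕ → ℕ
  | 0 => 1
  | 1 => 1
  | 2 => 2
  | 3 => 4
  -- The general recursion would give 10. The saving propagates to all larger even arguments and is
  -- needed for the comparison at odd `n`.
  | 4 => 9
  | m + 5 => (m + 6) / 2 * (1 + (m + 5) / 2 * pathBound (m + 3))

lemma pathBound_pos (m : ℕ) : 1 ≤ pathBound m := by
  match m with
  | 0 | 1 | 2 | 3 | 4 => simp [pathBound]
  | m + 5 =>
    rw [pathBound]
    exact Nat.mul_pos (by omega) (by omega)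

/-- The quadratic in `d` peaks at `(m + 1/t)/2`, between `m/2` and `(m+1)/2`, so its integer maximum
is at `⌈m/2⌉`. -/
lemma mul_one_add_sub_mul_le {m d t : ℕ} (hd : d ≤ m) (ht : 1 ≤ t) :
    d * (1 + (m - d) * t) ≤ (m + 1) / 2 * (1 + m / 2 * t) := by
  rcases Nat.even_or_odd' m with ⟨a, rfl | rfl⟩
  · rw [show (2 * a + 1) / 2 = a by omega, show 2 * a / 2 = a by omega]
    zify [hd]
    zify at ht
    nlinarith [mul_nonneg (sq_nonneg ((d : ℤ) - a)) (sub_nonneg.2 ht), sq_nonneg ((d : ℤ) - a),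
      Int.le_self_sq ((d : ℤ) - a)]
  · rw [show (2 * a + 1 + 1) / 2 = a + 1 by omega, show (2 * a + 1) / 2 = a by omega]
    zify [hd]
    zify at ht
    have h := Int.le_self_sq (-((d : ℤ) - a - 1))
    have h' : 0 ≤ ((d : ℤ) - a - 1) * (d - a) := by nlinarith
    nlinarith [mul_nonneg h' (sub_nonneg.2 ht), sq_nonneg ((d : ℤ) - a - 1)]

lemma one_add_mul_sub_mul_le {m d t : ℕ} (hm : 1 ≤ m) (hd : d ≤ m) :
    1 + d * ((m - d) * t) ≤ (m + 1) / 2 * (1 + m / 2 * t) := by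
  have h1 : d * (m - d) ≤ (m + 1) / 2 * (m / 2) := by
    rcases Nat.even_or_odd' m with ⟨a, rfl | rfl⟩
    · rw [show (2 * a + 1) / 2 = a by omega, show 2 * a / 2 = a by omega]
      zify [hd]
      nlinarith [sq_nonneg ((d : ℤ) - a)]
    · rw [show (2 * a + 1 + 1) / 2 = a + 1 by omega, show (2 * a + 1) / 2 = a by omega]
      zify [hd]
      nlinarith [Int.le_self_sq (-((d : ℤ) - a - 1))]
  have h2 : 1 ≤ (m + 1) / 2 := by omega
  calc 1 + d * ((m - d) * t) = 1 + d * (m - d) * t := by ring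
    _ ≤ (m + 1) / 2 + (m + 1) / 2 * (m / 2) * t :=
        Nat.add_le_add h2 (Nat.mul_le_mul_right _ h1)
    _ = _ := by ring

variable [DecidableEq V]

open Classical in
lemma numPathsIn_eq_ite_add [Finite V] {W : Finset V} {x z : V} (hx : x ∈ W) (hz : z ∈ W) (hxz : x ≠ z) :
    G.numPathsIn W x z = (if G.Adj x z then 1 else 0) +
      ∑ y ∈ G.nbrsIn ((W.erase x).erase z) x, G.numPathsIn (W.erase x) y z := by
  have hz' : z ∈ W.erase x := Finset.mem_erase.2 ⟨hxz.symm, hz⟩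
  have hzn : z ∉ G.nbrsIn ((W.erase x).erase z) x := by simp
  rw [numPathsIn_of_ne hx hxz]
  split_ifs with h
  · have : G.nbrsIn (W.erase x) x = insert z (G.nbrsIn ((W.erase x).erase z) x) := by
      ext y
      by_cases hy : y = z
      · subst hy; simpa [h] using And.intro hxz.symm hz
      · simp [hy]
    rw [this, Finset.sum_insert hzn, numPathsIn_self _ hz']
  · have : G.nbrsIn (W.erase x) x = G.nbrsIn ((W.erase x).erase z) x := by
      ext y
      by_cases hy : y = z
      · subst hy; simp [h]
      · simp [hy]
    rw [this, zero_add]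

lemma card_nbrsIn_add_card_nbrsIn_le (hG : G.CliqueFree 3) {W : Finset V} {x y : V}
    (hxy : G.Adj x y) : (G.nbrsIn W x).card + (G.nbrsIn W y).card ≤ W.card := by
  rw [← Finset.card_union_of_disjoint]
  · refine Finset.card_le_card fun u hu => ?_
    rcases Finset.mem_union.1 hu with h | h <;> exact (mem_nbrsIn.1 h).1
  · rw [Finset.disjoint_left]
    intro u hu hu'
    exact hG.not_adj_of_adj_of_adj hxy (mem_nbrsIn.1 hu').2 (mem_nbrsIn.1 hu).2

omit [DecidableEq V] in
lemma card_nbrsIn_le (W : Finset V) (x : V) : (G.nbrsIn W x).card ≤ W.card :=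
  Finset.card_le_card fun _ h => (mem_nbrsIn.1 h).1

/-- `HasPathBound G m t` says that any two distinct vertices of `G` are joined by at most `t` paths
inside any vertex set having exactly `m` further vertices. -/
def HasPathBound (G : SimpleGraph V) (m t : ℕ) : Prop :=
  ∀ (W : Finset V) (x z : V), x ∈ W → z ∈ W → x ≠ z → W.card = m + 2 → G.numPathsIn W x z ≤ t

lemma card_erase_erase {W : Finset V} {x z : V} {m : ℕ} (hx : x ∈ W) (hz : z ∈ W) (hxz : x ≠ z)
    (hW : W.card = m + 2) : ((W.erase x).erase z).card = m := by
  rw [Finset.card_erase_of_mem (Finset.mem_erase.2 ⟨hxz.symm, hz⟩), Finset.card_erase_of_mem hx, hW]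
  rfl

open Classical in
lemma numPathsIn_le_ite_add [Finite V] {m t : ℕ} (ht : G.HasPathBound m t) {W : Finset V} {x z : V}
    (hx : x ∈ W) (hz : z ∈ W) (hxz : x ≠ z) (hW : W.card = m + 3) :
    G.numPathsIn W x z ≤ (if G.Adj x z then 1 else 0) +
      (G.nbrsIn ((W.erase x).erase z) x).card * t := by
  rw [numPathsIn_eq_ite_add hx hz hxz, ← smul_eq_mul]
  refine Nat.add_le_add_left (Finset.sum_le_card_nsmul _ _ _ fun y hy => ?_) _
  have hy := (mem_nbrsIn.1 hy).1
  exact ht _ _ _ (Finset.mem_of_mem_erase hy) (Finset.mem_erase.2 ⟨hxz.symm, hz⟩)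
    (Finset.ne_of_mem_erase hy) (by rw [Finset.card_erase_of_mem hx, hW]; rfl)

open Classical in
-- After one of the `d` first steps `x → y`, the next vertex other than `z` avoids the neighborhood
-- of `x`, leaving at most `m + 2 - d` choices. A neighbor `y` of `x` can step straight to `z` only
-- if `x` and `z` are not adjacent; otherwise the edge `xz` is the one extra path.
lemma numPathsIn_le_of_triangleFree [Finite V] (hG : G.CliqueFree 3) {m t : ℕ} (ht : G.HasPathBound m t)
    {W : Finset V} {x z : V} (hx : x ∈ W) (hz : z ∈ W) (hxz : x ≠ z) (hW : W.card = m + 4) :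
    ∃ d ≤ m + 2, d = (G.nbrsIn ((W.erase x).erase z) x).card ∧
      ((G.Adj x z ∧ G.numPathsIn W x z ≤ 1 + d * ((m + 2 - d) * t)) ∨
        (¬ G.Adj x z ∧ G.numPathsIn W x z ≤ d * (1 + (m + 2 - d) * t))) := by
  have hU : ((W.erase x).erase z).card = m + 2 := card_erase_erase hx hz hxz hW
  have hz' : z ∈ W.erase x := Finset.mem_erase.2 ⟨hxz.symm, hz⟩
  refine ⟨_, hU ▸ card_nbrsIn_le _ _, rfl, ?_⟩
  set D := G.nbrsIn ((W.erase x).erase z) x with hD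
  have key : ∀ y ∈ D, G.numPathsIn (W.erase x) y z ≤
      (if G.Adj y z then 1 else 0) + (m + 2 - D.card) * t := fun y hy => by
    have hy := mem_nbrsIn.1 hy
    refine (numPathsIn_le_ite_add ht (Finset.mem_of_mem_erase hy.1) hz'
      (Finset.ne_of_mem_erase hy.1) (by rw [Finset.card_erase_of_mem hx, hW]; rfl)).trans ?_
    refine Nat.add_le_add_left (Nat.mul_le_mul_right _ ?_) _
    have h1 := card_nbrsIn_add_card_nbrsIn_le hG (W := (W.erase x).erase z) hy.2
    have h2 : (G.nbrsIn (((W.erase x).erase y).erase z) y).card ≤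
        (G.nbrsIn ((W.erase x).erase z) y).card := Finset.card_le_card fun u hu => by
      simp only [mem_nbrsIn, Finset.mem_erase] at hu ⊢
      tauto
    rw [← hD] at h1
    omega
  by_cases hadj : G.Adj x z
  · refine Or.inl ⟨hadj, ?_⟩
    rw [numPathsIn_eq_ite_add hx hz hxz, if_pos hadj, ← smul_eq_mul D.card]
    refine Nat.add_le_add_left (Finset.sum_le_card_nsmul _ _ _ fun y hy => ?_) _
    have h := key y hy
    rwa [if_neg (hG.not_adj_of_adj_of_adj (mem_nbrsIn.1 hy).2.symm hadj), zero_add] at h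
  · refine Or.inr ⟨hadj, ?_⟩
    rw [numPathsIn_eq_ite_add hx hz hxz, if_neg hadj, zero_add, ← smul_eq_mul D.card]
    refine Finset.sum_le_card_nsmul _ _ _ fun y hy => (key y hy).trans ?_
    gcongr
    split_ifs <;> simp

lemma HasPathBound.add_two [Finite V] (hG : G.CliqueFree 3) {m t : ℕ} (ht : G.HasPathBound m t)
    (h1 : 1 ≤ t) : G.HasPathBound (m + 2) ((m + 3) / 2 * (1 + (m + 2) / 2 * t)) := by
  intro W x z hx hz hxz hW
  obtain ⟨d, hd, -, h | h⟩ := numPathsIn_le_of_triangleFree hG ht hx hz hxz hW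
  · exact h.2.trans (one_add_mul_sub_mul_le (by omega) hd)
  · exact h.2.trans (mul_one_add_sub_mul_le hd h1)

lemma hasPathBound_zero [Finite V] : G.HasPathBound 0 1 := by
  classical
  intro W x z hx hz hxz hW
  have h := card_nbrsIn_le (G := G) ((W.erase x).erase z) x
  rw [card_erase_erase hx hz hxz hW, Nat.le_zero, Finset.card_eq_zero] at h
  rw [numPathsIn_eq_ite_add hx hz hxz, h, Finset.sum_empty]
  split_ifs <;> simp

lemma hasPathBound_one [Finite V] (hG : G.CliqueFree 3) : G.HasPathBound 1 1 := by
  classical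
  intro W x z hx hz hxz hW
  have h := card_nbrsIn_le (G := G) ((W.erase x).erase z) x
  rw [card_erase_erase hx hz hxz hW] at h
  rw [numPathsIn_eq_ite_add hx hz hxz]
  split_ifs with hadj
  · refine (Nat.add_le_add_left (Finset.sum_eq_zero fun y hy => ?_).le _).trans le_rfl
    have hy' := mem_nbrsIn.1 hy
    have hyW : y ∈ W.erase x := Finset.mem_of_mem_erase hy'.1
    have hz' : z ∈ W.erase x := Finset.mem_erase.2 ⟨hxz.symm, hz⟩
    have hU' := card_erase_erase (m := 0) hyW hz' (Finset.ne_of_mem_erase hy'.1)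
      (by rw [Finset.card_erase_of_mem hx, hW])
    rw [numPathsIn_eq_ite_add hyW hz' (Finset.ne_of_mem_erase hy'.1),
      if_neg (hG.not_adj_of_adj_of_adj hy'.2.symm hadj), Finset.card_eq_zero.1 hU']
    simp [nbrsIn]
  · rw [zero_add]
    refine (Finset.sum_le_card_nsmul _ _ 1 fun y hy => ?_).trans (by simpa using h)
    have hy := (mem_nbrsIn.1 hy).1
    exact hasPathBound_zero _ _ _ (Finset.mem_of_mem_erase hy)
      (Finset.mem_erase.2 ⟨hxz.symm, hz⟩) (Finset.ne_of_mem_erase hy)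
      (by rw [Finset.card_erase_of_mem hx, hW])

lemma numPathsIn_le_four [Finite V] (hG : G.CliqueFree 3) {W : Finset V} {y z : V} (hy : y ∈ W) (hz : z ∈ W)
    (hyz : y ≠ z) (hW : W.card = 5) (hd : (G.nbrsIn ((W.erase y).erase z) y).card ≤ 2) :
    G.numPathsIn W y z ≤ 4 := by
  classical
  have h2 : G.HasPathBound 2 2 := hasPathBound_zero.add_two hG le_rfl
  have h := numPathsIn_le_ite_add h2 hy hz hyz hW
  split_ifs at h with hadj
  swap
  · omega
  rcases Nat.lt_or_ge (G.nbrsIn ((W.erase y).erase z) y).card 2 with hd' | hd'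
  · omega
  have hz' : z ∈ W.erase y := Finset.mem_erase.2 ⟨hyz.symm, hz⟩
  have hU := card_erase_erase hy hz hyz hW
  set D := G.nbrsIn ((W.erase y).erase z) y with hD
  -- For adjacent ends the general estimate is `1 + 2 * 2`, one too many. But `w` is not adjacent to
  -- `z`, and it has at most `3 - 2` neighbors among the other vertices.
  suffices ∀ w ∈ D, G.numPathsIn (W.erase y) w z ≤ 1 by
    rw [numPathsIn_eq_ite_add hy hz hyz, if_pos hadj, ← hD]
    have := Finset.sum_le_card_nsmul D _ 1 this
    rw [smul_eq_mul] at this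
    omega
  intro w hw
  have hw' := mem_nbrsIn.1 hw
  have hwz : ¬ G.Adj w z := hG.not_adj_of_adj_of_adj hw'.2.symm hadj
  have hwW : w ∈ W.erase y := Finset.mem_of_mem_erase hw'.1
  have h1 := numPathsIn_le_ite_add (hasPathBound_one hG) hwW hz' (Finset.ne_of_mem_erase hw'.1)
    (by rw [Finset.card_erase_of_mem hy, hW])
  rw [if_neg hwz, zero_add, mul_one] at h1
  refine h1.trans ?_
  have h3 := card_nbrsIn_add_card_nbrsIn_le hG (W := (W.erase y).erase z) hw'.2
  have h4 : (G.nbrsIn (((W.erase y).erase w).erase z) w).card ≤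
      (G.nbrsIn ((W.erase y).erase z) w).card := Finset.card_le_card fun u hu => by
    simp only [mem_nbrsIn, Finset.mem_erase] at hu ⊢
    tauto
  rw [← hD, hU] at h3
  omega

lemma hasPathBound_four [Finite V] (hG : G.CliqueFree 3) : G.HasPathBound 4 9 := by
  classical
  intro W x z hx hz hxz hW
  have h2 : G.HasPathBound 2 2 := hasPathBound_zero.add_two hG le_rfl
  obtain ⟨d, hd, hd', h | h⟩ := numPathsIn_le_of_triangleFree hG h2 hx hz hxz hW
  · exact h.2.trans (by interval_cases d <;> norm_num)
  -- Only `d = 2` makes `d * (1 + (4 - d) * 2)` exceed 9; there the refined bound gives `2 * 4`.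
  · by_cases hd2 : d = 2
    · have hz' : z ∈ W.erase x := Finset.mem_erase.2 ⟨hxz.symm, hz⟩
      rw [numPathsIn_eq_ite_add hx hz hxz, if_neg h.1, zero_add]
      refine (Finset.sum_le_card_nsmul _ _ 4 fun y hy => ?_).trans ?_
      · have hy' := mem_nbrsIn.1 hy
        refine numPathsIn_le_four hG (Finset.mem_of_mem_erase hy'.1) hz'
          (Finset.ne_of_mem_erase hy'.1) (by rw [Finset.card_erase_of_mem hx, hW]) ?_
        have h3 := card_nbrsIn_add_card_nbrsIn_le hG (W := (W.erase x).erase z) hy'.2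
        rw [card_erase_erase hx hz hxz hW] at h3
        have h4 : (G.nbrsIn (((W.erase x).erase y).erase z) y).card ≤
            (G.nbrsIn ((W.erase x).erase z) y).card := Finset.card_le_card fun u hu => by
          simp only [mem_nbrsIn, Finset.mem_erase] at hu ⊢
          tauto
        omega
      · rw [← hd', hd2]; norm_num
    · exact h.2.trans (by interval_cases d <;> omega)

theorem hasPathBound [Finite V] (hG : G.CliqueFree 3) (m : ℕ) : G.HasPathBound m (pathBound m) := by
  match m with
  | 0 => exact hasPathBound_zero
  | 1 => exact hasPathBound_one hG
  | 2 => exact hasPathBound_zero.add_two hG le_rfl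
  | 3 => exact (hasPathBound_one hG).add_two hG le_rfl
  | 4 => exact hasPathBound_four hG
  | m + 5 =>
    rw [pathBound]
    exact (hasPathBound hG (m + 3)).add_two hG (pathBound_pos _)

end SimpleGraph

/-! ### Upper bound for cycles in triangle-free graphs -/

namespace SimpleGraph

variable {V : Type*} {G : SimpleGraph V}

/-- Strictness carries the induction: the extra 1 in `2 * t + 1` has a coefficient of at least 2,
which pays for doubling the constant term. -/
lemma two_mul_pathBound_lt (m : ℕ) : 2 * pathBound (m + 3) < pathBound (m + 4) := by
  match m with
  | 0 | 1 => simp [pathBound]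
  | m + 2 =>
    have ih := two_mul_pathBound_lt m
    rw [show pathBound (m + 2 + 3) = _ from by rw [pathBound],
      show pathBound (m + 2 + 4) = _ from by rw [pathBound]]
    generalize pathBound (m + 3) = t at *
    have ih : 2 * t + 1 ≤ pathBound (m + 4) := ih
    calc 2 * ((m + 6) / 2 * (1 + (m + 5) / 2 * t))
        < (m + 6) / 2 * (1 + (m + 5) / 2 * (2 * t + 1)) := by
          have h1 : 2 ≤ (m + 5) / 2 := by omega
          have h2 : 0 < (m + 6) / 2 := by omega
          nlinarith
      _ ≤ (m + 1 + 6) / 2 * (1 + (m + 1 + 5) / 2 * pathBound (m + 1 + 3)) := by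
          gcongr <;> omega

lemma two_mul_pathBound_le {m : ℕ} (hm : 1 ≤ m) : 2 * pathBound m ≤ pathBound (m + 1) := by
  match m with
  | 1 | 2 => simp [pathBound]
  | m + 3 => exact (two_mul_pathBound_lt m).le

variable [DecidableEq V]

lemma nbrsIn_erase_self (W : Finset V) (v : V) : G.nbrsIn (W.erase v) v = G.nbrsIn W v := by
  ext u
  simp only [mem_nbrsIn, Finset.mem_erase]
  exact ⟨fun h => ⟨h.1.2, h.2⟩, fun h => ⟨⟨h.2.ne.symm, h.1⟩, h.2⟩⟩

lemma exists_card_nbrsIn_le (hG : G.CliqueFree 3) {W : Finset V} (hW : W.Nonempty) :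
    ∃ v ∈ W, (G.nbrsIn W v).card ≤ W.card / 2 := by
  by_cases h : ∃ x ∈ W, ∃ y ∈ W, G.Adj x y
  · obtain ⟨x, hx, y, hy, hxy⟩ := h
    have h1 := card_nbrsIn_add_card_nbrsIn_le hG (W := W) hxy
    rcases le_total (G.nbrsIn W x).card (G.nbrsIn W y).card with h2 | h2
    · exact ⟨x, hx, by omega⟩
    · exact ⟨y, hy, by omega⟩
  · push Not at h
    obtain ⟨x, hx⟩ := hW
    refine ⟨x, hx, ?_⟩
    rw [Finset.card_eq_zero.2]
    · exact Nat.zero_le _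
    · exact Finset.eq_empty_of_forall_notMem fun y hy =>
        h x hx y (mem_nbrsIn.1 hy).1 (mem_nbrsIn.1 hy).2

variable [Finite V]

lemma two_mul_numCyclesIn_le_add (hG : G.CliqueFree 3) {W : Finset V} {v : V} (hv : v ∈ W)
    {m d : ℕ} (hW : W.card = m + 3) (hd : (G.nbrsIn W v).card ≤ d) :
    2 * G.numCyclesIn W ≤ 2 * G.numCyclesIn (W.erase v) + d * ((d - 1) * pathBound m) := by
  rw [two_mul_numCyclesIn hv, nbrsIn_erase_self]
  refine Nat.add_le_add_left ?_ _
  have hW' : (W.erase v).card = m + 2 := by rw [Finset.card_erase_of_mem hv, hW]; rfl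
  refine (Finset.sum_le_card_nsmul _ _ ((d - 1) * pathBound m) fun y hy => ?_).trans
    (Nat.mul_le_mul_right _ hd)
  refine (Finset.sum_le_card_nsmul _ _ (pathBound m) fun z hz => ?_).trans
    (Nat.mul_le_mul_right _ ?_)
  · have hz' := Finset.mem_erase.1 hz
    rw [← nbrsIn_erase_self] at hy hz'
    exact hasPathBound hG m _ _ _ (mem_nbrsIn.1 hy).1 (mem_nbrsIn.1 hz'.2).1 hz'.1.symm hW'
  · rw [Finset.card_erase_of_mem hy]
    omega

lemma numCyclesIn_eq_zero_of_card_le_two {W : Finset V} (hW : W.card ≤ 2) :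
    G.numCyclesIn W = 0 := by
  induction W using Finset.strongInduction with
  | H W ih =>
    rcases W.eq_empty_or_nonempty with rfl | ⟨v, hv⟩
    · exact numCyclesIn_empty
    · have h := two_mul_numCyclesIn (G := G) hv
      have h1 : (W.erase v).card ≤ 1 := by rw [Finset.card_erase_of_mem hv]; omega
      rw [ih _ (Finset.erase_ssubset hv) (by omega), Finset.sum_eq_zero] at h
      · omega
      · intro y hy
        have h2 : ((G.nbrsIn (W.erase v) v).erase y).card = 0 := by
          rw [Finset.card_erase_of_mem hy]
          have := card_nbrsIn_le (G := G) (W.erase v) v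
          omega
        rw [Finset.card_eq_zero.1 h2, Finset.sum_empty]

/-- An absolute upper bound for the number of cycles of a triangle-free graph. -/
lemma numCyclesIn_le (hG : G.CliqueFree 3) (m : ℕ) {W : Finset V} (hW : W.card = m + 3) :
    G.numCyclesIn W ≤ (m + 3) / 2 * (((m + 3) / 2 - 1) * pathBound m) := by
  induction m generalizing W with
  | zero =>
    obtain ⟨v, hv, hd⟩ := exists_card_nbrsIn_le hG (W := W) (Finset.card_pos.1 (by omega))
    have h := two_mul_numCyclesIn_le_add hG hv hW (hd.trans_eq (by rw [hW]))
    rw [numCyclesIn_eq_zero_of_card_le_two (W := W.erase v)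
      (by rw [Finset.card_erase_of_mem hv]; omega)] at h
    omega
  | succ m ih =>
    obtain ⟨v, hv, hd⟩ := exists_card_nbrsIn_le hG (W := W) (Finset.card_pos.1 (by omega))
    have h := two_mul_numCyclesIn_le_add hG hv hW (hd.trans_eq (by rw [hW]))
    have h2 := ih (W := W.erase v) (by rw [Finset.card_erase_of_mem hv]; omega)
    -- The claimed bound at least doubles at each step, so the cycles avoiding `v` use at most half
    -- of it, and those through `v` the other half. `pathBound` itself does not double from 0 to 1,
    -- but for `m = 0` the left side vanishes.
    have h3 : 2 * ((m + 3) / 2 * (((m + 3) / 2 - 1) * pathBound m)) ≤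
        (m + 1 + 3) / 2 * (((m + 1 + 3) / 2 - 1) * pathBound (m + 1)) := by
      rcases Nat.eq_zero_or_pos m with rfl | hm
      · simp
      calc 2 * ((m + 3) / 2 * (((m + 3) / 2 - 1) * pathBound m))
          = (m + 3) / 2 * (((m + 3) / 2 - 1) * (2 * pathBound m)) := by ring
        _ ≤ _ := by
          gcongr
          · omega
          · omega
          · exact two_mul_pathBound_le hm
    omega

theorem two_mul_numCycles_le [Fintype V] (hG : G.CliqueFree 3) {v : V} {m d : ℕ}
    (hV : Fintype.card V = m + 4) (hd : (G.nbrsIn Finset.univ v).card ≤ d) :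
    2 * G.numCycles ≤ d * ((d - 1) * pathBound (m + 1)) +
      2 * ((m + 3) / 2 * (((m + 3) / 2 - 1) * pathBound m)) := by
  have h := two_mul_numCyclesIn_le_add hG (Finset.mem_univ v) (m := m + 1)
    (by rw [Finset.card_univ, hV]) hd
  have h2 := numCyclesIn_le hG m (W := Finset.univ.erase v)
    (by rw [Finset.card_erase_of_mem (Finset.mem_univ v), Finset.card_univ, hV]; rfl)
  rw [numCyclesIn_univ] at h
  omega

end SimpleGraph

/-! ### Exact counts in complete bipartite graphs, and the gain from balancing -/

namespace SimpleGraph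

variable {V : Type*} {G : SimpleGraph V}

/-- The number of paths between two vertices of the same side of a complete bipartite graph, which
has `q` further vertices on that side and `p` vertices on the other. -/
def bipPaths : ℕ → ℕ → ℕ
  | 0, _ => 0
  | p + 1, 0 => p + 1
  | p + 1, q + 1 => (p + 1) * (1 + (q + 1) * bipPaths p q)

lemma bipPaths_succ (p q : ℕ) : bipPaths (p + 1) q = (p + 1) * (1 + q * bipPaths p (q - 1)) := by
  cases q <;> simp [bipPaths]

/-- Twice the number of cycles of a complete bipartite graph with sides of sizes `p` and `q`. -/
def bipCycles : ℕ → ℕ → ℕ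
  | 0, _ => 0
  | p + 1, q => bipCycles p q + q * ((q - 1) * bipPaths p (q - 2))

/-- `IsCompleteBip G s` says that `G` is the complete bipartite graph whose sides are the fibers of
`s`. -/
def IsCompleteBip (G : SimpleGraph V) (s : V → Bool) : Prop := ∀ u v, G.Adj u v ↔ s u ≠ s v

lemma IsCompleteBip.not {s : V → Bool} (hs : G.IsCompleteBip s) :
    G.IsCompleteBip fun v => !(s v) := fun u v => by rw [hs u v]; simp

variable [DecidableEq V] [Finite V]

lemma IsCompleteBip.numPathsIn_eq {s : V → Bool} (hs : G.IsCompleteBip s) {W : Finset V} {x z : V}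
    {p q : ℕ} (hx : x ∈ W) (hz : z ∈ W) (hxz : x ≠ z) (hsx : s x = s z)
    (hp : (W.filter (s · ≠ s z)).card = p) (hq : (W.filter (s · = s z)).card = q + 2) :
    G.numPathsIn W x z = bipPaths p q := by
  classical
  induction p generalizing W x q with
  | zero =>
    rw [numPathsIn_eq_ite_add hx hz hxz, if_neg (by simp [hs x z, hsx]), zero_add,
      Finset.sum_eq_zero, bipPaths]
    intro y hy
    simp only [mem_nbrsIn, Finset.mem_erase, hs x y, hsx] at hy
    exact absurd (Finset.mem_filter.2 ⟨hy.1.2.2, hy.2.symm⟩)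
      (by rw [Finset.card_eq_zero.1 hp]; simp)
  | succ p ih =>
    rw [bipPaths_succ, numPathsIn_eq_ite_add hx hz hxz, if_neg (by simp [hs x z, hsx]), zero_add]
    have hD : G.nbrsIn ((W.erase x).erase z) x = W.filter (s · ≠ s z) := by
      ext y
      simp only [mem_nbrsIn, Finset.mem_erase, hs x y, Finset.mem_filter, hsx]
      constructor
      · exact fun h => ⟨h.1.2.2, h.2.symm⟩
      · exact fun h => ⟨⟨by rintro rfl; exact h.2 rfl, by rintro rfl; exact h.2 hsx, h.1⟩, h.2.symm⟩
    rw [hD, ← hp, ← smul_eq_mul]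
    refine Finset.sum_eq_card_nsmul fun y hy => ?_
    obtain ⟨hyW, hyz⟩ := Finset.mem_filter.1 hy
    have hyx : y ≠ x := by rintro rfl; exact hyz hsx
    have hyz' : y ≠ z := by rintro rfl; exact hyz rfl
    have hyW' : y ∈ W.erase x := Finset.mem_erase.2 ⟨hyx, hyW⟩
    have hzW' : z ∈ W.erase x := Finset.mem_erase.2 ⟨hxz.symm, hz⟩
    -- From `y` the path either ends at `z` or returns to the side of `x`; in the latter case `x`
    -- and `y` are used up and induction applies.
    rw [numPathsIn_eq_ite_add hyW' hzW' hyz', if_pos ((hs y z).2 hyz)]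
    congr 1
    have hE : G.nbrsIn (((W.erase x).erase y).erase z) y =
        ((W.filter (s · = s z)).erase x).erase z := by
      ext u
      simp only [mem_nbrsIn, Finset.mem_erase, hs y u, Finset.mem_filter]
      constructor
      · rintro ⟨⟨h1, h2, h3, h4⟩, h5⟩
        refine ⟨h1, h3, h4, ?_⟩
        revert h5 hyz
        cases s u <;> cases s y <;> cases s z <;> simp
      · rintro ⟨h1, h2, h3, h4⟩
        exact ⟨⟨h1, by rintro rfl; exact hyz h4, h2, h3⟩, by rw [h4]; exact hyz⟩
    have hEc : (((W.filter (s · = s z)).erase x).erase z).card = q :=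
      card_erase_erase (by simp [hx, hsx]) (by simp [hz]) hxz hq
    rw [hE, ← smul_eq_mul]
    conv_rhs => rw [← hEc]
    refine Finset.sum_eq_card_nsmul fun w hw => ?_
    have hw' := hw
    simp only [Finset.mem_erase, Finset.mem_filter] at hw'
    obtain ⟨hwz, hwx, hwW, hswz⟩ := hw'
    have hq1 : 1 ≤ q := by rw [← hEc]; exact Finset.card_pos.2 ⟨w, hw⟩
    have hwy : w ≠ y := by rintro rfl; exact hyz hswz
    refine ih (Finset.mem_erase.2 ⟨hwy, Finset.mem_erase.2 ⟨hwx, hwW⟩⟩)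
      (Finset.mem_erase.2 ⟨hyz'.symm, hzW'⟩) hwz hswz ?_ ?_
    · rw [Finset.filter_erase, Finset.filter_erase, Finset.card_erase_of_mem,
        Finset.erase_eq_of_notMem, hp]
      · rfl
      · simp [hsx]
      · rw [Finset.erase_eq_of_notMem (by simp [hsx])]
        exact hy
    · rw [Finset.filter_erase, Finset.filter_erase, Finset.erase_eq_of_notMem,
        Finset.card_erase_of_mem, hEc, hq]
      · omega
      · simp [hx, hsx]
      · simp [hyz]

lemma IsCompleteBip.two_mul_numCyclesIn_eq {s : V → Bool} (hs : G.IsCompleteBip s) {W : Finset V}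
    {p q : ℕ} (hp : (W.filter (s · = true)).card = p) (hq : (W.filter (s · = false)).card = q) :
    2 * G.numCyclesIn W = bipCycles p q := by
  classical
  induction p generalizing W with
  | zero =>
    rw [bipCycles, Nat.mul_eq_zero]
    right
    rw [numCyclesIn, Set.ncard_eq_zero (Set.toFinite _), Set.eq_empty_iff_forall_notMem]
    rintro H ⟨⟨v, w, hw, rfl⟩, h⟩
    have hfalse : ∀ u ∈ W, s u = false := fun u hu => by
      by_contra hne
      have : u ∈ W.filter (s · = true) := Finset.mem_filter.2 ⟨hu, by simpa using hne⟩
      rw [Finset.card_eq_zero.1 hp] at this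
      simp at this
    have hadj := w.adj_snd hw.not_nil
    have h1 := hfalse v (h w.start_mem_verts_toSubgraph)
    have h2 := hfalse w.snd (h (w.mem_verts_toSubgraph.2 (w.getVert_mem_support 1)))
    exact (hs _ _).1 hadj (h1.trans h2.symm)
  | succ p ih =>
    obtain ⟨v, hv⟩ := Finset.card_pos.1 (hp.symm ▸ Nat.succ_pos p : 0 < (W.filter (s · = true)).card)
    obtain ⟨hvW, hsv⟩ := Finset.mem_filter.1 hv
    have hp' : ((W.erase v).filter (s · = true)).card = p := by
      rw [Finset.filter_erase, Finset.card_erase_of_mem hv, hp]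
      rfl
    have hq' : (W.erase v).filter (s · = false) = W.filter (s · = false) := by
      rw [Finset.filter_erase, Finset.erase_eq_of_notMem]
      simp [hsv]
    have hN : G.nbrsIn (W.erase v) v = W.filter (s · = false) := by
      ext u
      rw [nbrsIn_erase_self, mem_nbrsIn, Finset.mem_filter, hs v u, hsv]
      cases s u <;> simp
    rw [two_mul_numCyclesIn hvW, bipCycles, ih hp' (by rw [hq', hq]), hN]
    congr 1
    rw [← smul_eq_mul q, ← smul_eq_mul (q - 1)]
    conv_rhs => rw [← hq]
    refine Finset.sum_eq_card_nsmul fun y hy => ?_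
    rw [← Finset.card_erase_of_mem hy]
    refine Finset.sum_eq_card_nsmul fun z hz => ?_
    obtain ⟨hzy, hz⟩ := Finset.mem_erase.1 hz
    have hq2 : 2 ≤ q := by
      rw [← hq, ← Finset.card_pair hzy]
      exact Finset.card_le_card fun u hu => by
        rcases Finset.mem_insert.1 hu with rfl | hu
        · exact hz
        · rwa [Finset.mem_singleton.1 hu]
    rw [hq]
    have hsy := (Finset.mem_filter.1 hy).2
    have hsz := (Finset.mem_filter.1 hz).2
    rw [← hq'] at hy hz
    refine hs.numPathsIn_eq (Finset.mem_filter.1 hy).1 (Finset.mem_filter.1 hz).1 hzy.symm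
      (hsy.trans hsz.symm) ?_ ?_
    · simpa [hsz] using hp'
    · rw [hsz, hq', hq]
      omega

omit [DecidableEq V] [Finite V] in
lemma IsCompleteBip.two_mul_numCycles_eq [Fintype V] {s : V → Bool} (hs : G.IsCompleteBip s)
    {p q : ℕ} (hp : (Finset.univ.filter (s · = true)).card = p)
    (hq : (Finset.univ.filter (s · = false)).card = q) : 2 * G.numCycles = bipCycles p q := by
  classical
  rw [← numCyclesIn_univ]
  exact hs.two_mul_numCyclesIn_eq hp hq

lemma isCompleteBip_completeBipartiteGraph (α β : Type*) :
    (completeBipartiteGraph α β).IsCompleteBip Sum.isLeft := by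
  rintro (a | a) (b | b) <;> simp

lemma card_filter_isLeft_eq_true (p q : ℕ) :
    (Finset.univ.filter fun x : Fin p ⊕ Fin q => x.isLeft = true).card = p := by
  rw [show (Finset.univ.filter fun x : Fin p ⊕ Fin q => x.isLeft = true) =
    Finset.univ.map .inl by ext (a | a) <;> simp, Finset.card_map, Finset.card_univ,
    Fintype.card_fin]

lemma card_filter_isLeft_eq_false (p q : ℕ) :
    (Finset.univ.filter fun x : Fin p ⊕ Fin q => x.isLeft = false).card = q := by
  rw [show (Finset.univ.filter fun x : Fin p ⊕ Fin q => x.isLeft = false) =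
    Finset.univ.map .inr by ext (a | a) <;> simp, Finset.card_map, Finset.card_univ,
    Fintype.card_fin]

lemma two_mul_numCycles_completeBipartiteGraph (p q : ℕ) :
    2 * (completeBipartiteGraph (Fin p) (Fin q)).numCycles = bipCycles p q :=
  (isCompleteBip_completeBipartiteGraph _ _).two_mul_numCycles_eq
    (card_filter_isLeft_eq_true p q) (card_filter_isLeft_eq_false p q)

/-- The recursion treats the sides asymmetrically; symmetry follows by counting the cycles of one
graph with its sides swapped. -/
lemma bipCycles_comm (p q : ℕ) : bipCycles p q = bipCycles q p := by
  rw [← two_mul_numCycles_completeBipartiteGraph]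
  refine (isCompleteBip_completeBipartiteGraph _ _).not.two_mul_numCycles_eq ?_ ?_
  · simpa using card_filter_isLeft_eq_false p q
  · simpa using card_filter_isLeft_eq_true p q

/-- Unfolding both `bipPaths` once exposes a common factor; what remains is the previous case plus
the comparison of the sizes. -/
lemma mul_bipPaths_lt {p q : ℕ} (h : q + 2 < p) :
    (q + 2) * ((q + 1) * bipPaths p q) < p * ((p - 1) * bipPaths (q + 2) (p - 2)) := by
  induction q generalizing p with
  | zero =>
    obtain ⟨p, rfl⟩ : ∃ r, p = r + 3 := ⟨p - 3, by omega⟩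
    simp only [bipPaths_succ, bipPaths]
    simp only [show p + 3 - 1 = p + 2 from rfl, show p + 3 - 2 = p + 1 from rfl,
      Nat.add_sub_cancel]
    nlinarith [Nat.zero_le (p * p * p), Nat.zero_le (p * p * p * p)]
  | succ q ih =>
    obtain ⟨p, rfl⟩ : ∃ r, p = r + 3 := ⟨p - 3, by omega⟩
    have ih := ih (p := p + 2) (by omega)
    rw [bipPaths_succ, bipPaths_succ (q + 2)]
    simp only [show p + 3 - 1 = p + 2 from rfl, show p + 3 - 2 = p + 1 from rfl,
      show p + 2 - 1 = p + 1 from rfl, show p + 2 - 2 = p from rfl, Nat.add_sub_cancel] at ih ⊢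
    generalize bipPaths (p + 2) q = a at *
    generalize bipPaths (q + 2) p = b at *
    calc (q + 1 + 2) * ((q + 1 + 1) * ((p + 3) * (1 + (q + 1) * a)))
        = (q + 3) * (p + 3) * (q + 2 + (q + 2) * ((q + 1) * a)) := by ring
      _ < (q + 3) * (p + 3) * (p + 2 + (p + 2) * ((p + 1) * b)) := by
          gcongr
          omega
      _ = _ := by ring

/-- Both graphs become the same one, with sides `s` and `t`, after deleting a vertex, so only the
cycles through that vertex matter. -/
lemma bipCycles_succ_lt {s t : ℕ} (ht : 1 ≤ t) (hst : t < s) :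
    bipCycles (s + 1) t < bipCycles s (t + 1) := by
  rw [bipCycles_comm s (t + 1), bipCycles, bipCycles, bipCycles_comm t s]
  gcongr ?_ + ?_
  rcases Nat.lt_or_ge t 2 with h | h
  · obtain rfl : t = 1 := by omega
    simp only [bipPaths_succ]
    simp only [Nat.sub_self, zero_mul, mul_zero]
    have h1 : 0 < s - 1 := by omega
    positivity
  · obtain ⟨q, rfl⟩ : ∃ q, t = q + 2 := ⟨t - 2, by omega⟩
    exact mul_bipPaths_lt hst

lemma bipCycles_lt {n s t : ℕ} (hn : 4 ≤ n) (hst : s + t = n) (h : t + 2 ≤ s) :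
    bipCycles s t < bipCycles ((n + 1) / 2) (n / 2) := by
  induction s using Nat.strong_induction_on generalizing t with
  | _ s ih =>
    obtain ⟨s, rfl⟩ : ∃ r, s = r + 1 := ⟨s - 1, by omega⟩
    rcases Nat.lt_or_ge s (t + 3) with h1 | h1
    · have := bipCycles_succ_lt (s := s) (t := t) (by omega) (by omega)
      rwa [show s = (n + 1) / 2 by omega, show t + 1 = n / 2 by omega,
        show (n + 1) / 2 + 1 = s + 1 by omega] at this
    · have h2 := ih s (by omega) (t := t + 1) (by omega) (by omega)
      -- For `t = 0` moving one vertex yields a star, still without cycles, so that step is not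
      -- strict.
      rcases Nat.eq_zero_or_pos t with rfl | ht
      · rw [bipCycles_comm, bipCycles]
        exact (Nat.zero_le _).trans_lt h2
      · exact (bipCycles_succ_lt ht (by omega)).trans h2

end SimpleGraph

/-! ### The bipartite case -/

namespace SimpleGraph

variable {V : Type*} {G K : SimpleGraph V}

lemma map_ofLE_mem_cycleSubgraphs (h : G ≤ K) {H : G.Subgraph} (hH : H ∈ G.cycleSubgraphs) :
    H.map (Hom.ofLE h) ∈ K.cycleSubgraphs := by
  obtain ⟨v, p, hp, rfl⟩ := hH
  exact ⟨v, p.mapLe h, (Walk.isCycle_mapLe h).2 hp, p.toSubgraph_map (Hom.ofLE h)⟩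

lemma map_ofLE_adj (h : G ≤ K) (H : G.Subgraph) (u v : V) :
    (H.map (Hom.ofLE h)).Adj u v ↔ H.Adj u v := by
  simp [Subgraph.map]

lemma map_ofLE_injective (h : G ≤ K) : Function.Injective (Subgraph.map (Hom.ofLE h)) := by
  intro H H' hHH'
  refine Subgraph.ext ?_ ?_
  · have := congrArg Subgraph.verts hHH'
    simpa [Subgraph.map] using this
  · funext u v
    rw [← map_ofLE_adj h H, ← map_ofLE_adj h H', hHH']

variable [Fintype V]

lemma numCycles_mono (h : G ≤ K) : G.numCycles ≤ K.numCycles := by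
  classical
  rw [numCycles, ← Set.ncard_image_of_injective _ (map_ofLE_injective h)]
  refine Set.ncard_le_ncard ?_ (Set.toFinite _)
  rintro _ ⟨H, hH, rfl⟩
  exact map_ofLE_mem_cycleSubgraphs h hH

lemma numCycles_lt_of_isCycle (h : G ≤ K) {u v : V} (huv : ¬ G.Adj u v) {p : K.Walk u u}
    (hp : p.IsCycle) (hpuv : p.toSubgraph.Adj u v) : G.numCycles < K.numCycles := by
  classical
  rw [numCycles, ← Set.ncard_image_of_injective _ (map_ofLE_injective h)]
  refine Set.ncard_lt_ncard ⟨?_, fun hss => ?_⟩ (Set.toFinite _)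
  · rintro _ ⟨H, hH, rfl⟩
    exact map_ofLE_mem_cycleSubgraphs h hH
  · obtain ⟨H, -, hH⟩ := hss (⟨u, p, hp, rfl⟩ : p.toSubgraph ∈ K.cycleSubgraphs)
    rw [← hH, map_ofLE_adj] at hpuv
    exact huv hpuv.adj_sub

/-- With a second vertex on each side, a missing edge `uv` lies on the 4-cycle `u v u' v'` of `K`.
-/
lemma IsCompleteBip.numCycles_lt {s : V → Bool} (hs : K.IsCompleteBip s) (h : G < K)
    (ht : 2 ≤ (Finset.univ.filter (s · = true)).card)
    (hf : 2 ≤ (Finset.univ.filter (s · = false)).card) : G.numCycles < K.numCycles := by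
  classical
  have hside : ∀ u, ∃ u', u' ≠ u ∧ s u' = s u := fun u => by
    have h2 : 1 < (Finset.univ.filter (s · = s u)).card := by
      cases s u
      · exact hf
      · exact ht
    obtain ⟨u', hu', hne⟩ := Finset.exists_mem_ne h2 u
    exact ⟨u', hne, (Finset.mem_filter.1 hu').2⟩
  obtain ⟨u, v, hK, hGuv⟩ : ∃ u v, K.Adj u v ∧ ¬ G.Adj u v := by
    by_contra hcon
    push Not at hcon
    exact h.not_ge fun u v => hcon u v
  obtain ⟨u', hu', hsu⟩ := hside u
  obtain ⟨v', hv', hsv⟩ := hside v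
  have huv := (hs u v).1 hK
  have h1 : K.Adj v u' := (hs _ _).2 (by rw [hsu]; exact huv.symm)
  have h2 : K.Adj u' v' := (hs _ _).2 (by rw [hsu, hsv]; exact huv)
  have h3 : K.Adj v' u := (hs _ _).2 (by rw [hsv]; exact huv.symm)
  refine numCycles_lt_of_isCycle h.le hGuv
    (p := Walk.cons hK ((Walk.cons h1 (Walk.cons h2 Walk.nil)).concat h3)) ?_ ?_
  · refine isCycle_cons_concat _ _ _ ?_ ?_ hv'.symm
    · simp [hK.ne, hu'.symm, h3.ne.symm]
    · simp [Walk.cons_isPath_iff, h1.ne, h2.ne, hv'.symm]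
  · simp

lemma IsCompleteBip.nonempty_iso {s : V → Bool} (hs : G.IsCompleteBip s) {p q : ℕ}
    (hp : (Finset.univ.filter (s · = true)).card = p)
    (hq : (Finset.univ.filter (s · = false)).card = q) :
    Nonempty (G ≃g completeBipartiteGraph (Fin p) (Fin q)) := by
  classical
  have e1 : {v // s v = true} ≃ Fin p :=
    Fintype.equivFinOfCardEq (by rw [Fintype.card_subtype, hp])
  have e2 : {v // ¬ s v = true} ≃ Fin q :=
    Fintype.equivFinOfCardEq (by rw [Fintype.card_subtype, ← hq]; simp)
  let e := (Equiv.sumCompl fun v => s v = true).symm.trans (Equiv.sumCongr e1 e2)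
  have he : ∀ v, (e v).isLeft = s v := fun v => by
    by_cases h : s v = true <;> simp [e, Equiv.sumCompl, h]
  refine ⟨⟨e, fun {u v} => ?_⟩⟩
  rw [isCompleteBip_completeBipartiteGraph, he, he, hs u v]

lemma numCycles_le_balanced_aux {n : ℕ} (hn : 4 ≤ n) (hV : Fintype.card V = n) (s : V → Bool)
    (hs : ∀ u v, G.Adj u v → s u ≠ s v)
    (hle : (Finset.univ.filter (s · = false)).card ≤ (Finset.univ.filter (s · = true)).card) :
    G.numCycles ≤ (balancedCompleteBipartite n).numCycles ∧
      (G.numCycles = (balancedCompleteBipartite n).numCycles →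
        Nonempty (G ≃g balancedCompleteBipartite n)) := by
  classical
  have hsum : (Finset.univ.filter (s · = true)).card + (Finset.univ.filter (s · = false)).card
      = n := by
    rw [← hV, ← Finset.card_univ,
      ← Finset.card_filter_add_card_filter_not (s := Finset.univ) (s · = true)]
    simp
  let K : SimpleGraph V := ⟨fun u v => s u ≠ s v, ⟨fun _ _ h => h.symm⟩, ⟨fun _ h => h rfl⟩⟩
  have hK : K.IsCompleteBip s := fun _ _ => Iff.rfl
  have hGK : G ≤ K := fun u v h => hs u v h
  have h1 := numCycles_mono hGK
  have h2 := hK.two_mul_numCycles_eq rfl rfl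
  have h3 := two_mul_numCycles_completeBipartiteGraph ((n + 1) / 2) (n / 2)
  rcases Nat.lt_or_ge (Finset.univ.filter (s · = true)).card
    ((Finset.univ.filter (s · = false)).card + 2) with h | h
  · have ht : (Finset.univ.filter (s · = true)).card = (n + 1) / 2 := by omega
    have hf : (Finset.univ.filter (s · = false)).card = n / 2 := by omega
    rw [ht, hf] at h2
    have h4 : K.numCycles = (balancedCompleteBipartite n).numCycles := by
      rw [balancedCompleteBipartite]; omega
    refine ⟨h1.trans h4.le, fun heq => ?_⟩
    rcases hGK.lt_or_eq with hlt | rfl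
    · exact absurd (heq.trans h4.symm) (hK.numCycles_lt hlt (by omega) (by omega)).ne
    · exact hK.nonempty_iso ht hf
  · have h4 := bipCycles_lt hn hsum h
    have h5 : G.numCycles < (balancedCompleteBipartite n).numCycles := by
      rw [balancedCompleteBipartite]; omega
    exact ⟨h5.le, fun heq => absurd heq h5.ne⟩

theorem numCycles_le_balanced_of_colorable {n : ℕ} (hn : 4 ≤ n) (hV : Fintype.card V = n)
    (hG : G.Colorable 2) :
    G.numCycles ≤ (balancedCompleteBipartite n).numCycles ∧
      (G.numCycles = (balancedCompleteBipartite n).numCycles →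
        Nonempty (G ≃g balancedCompleteBipartite n)) := by
  classical
  obtain ⟨C⟩ := hG
  have hC : ∀ u v, G.Adj u v → decide (C u = 0) ≠ decide (C v = 0) := fun u v h => by
    have := C.valid h
    generalize C u = a at *
    generalize C v = b at *
    revert a b
    decide
  rcases le_total (Finset.univ.filter fun v => decide (C v = 0) = false).card
    (Finset.univ.filter fun v => decide (C v = 0) = true).card with h | h
  · exact numCycles_le_balanced_aux hn hV _ hC h
  · refine numCycles_le_balanced_aux hn hV (fun v => !decide (C v = 0))
      (fun u v huv => by simpa using hC u v huv) ?_
    simpa using h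

end SimpleGraph

/-! ### Numerical comparison of the bounds -/

namespace SimpleGraph

/-- The path bound is thus attained for an odd number of further vertices. -/
lemma bipPaths_succ_self (j : ℕ) : bipPaths (j + 1) j = pathBound (2 * j + 1) := by
  induction j with
  | zero => simp [bipPaths, pathBound]
  | succ j ih =>
    rw [bipPaths_succ, Nat.add_sub_cancel, ih]
    match j with
    | 0 => simp [pathBound]
    | j + 1 =>
      rw [show 2 * (j + 1 + 1) + 1 = 2 * j + 5 by ring, pathBound,
        show (2 * j + 6) / 2 = j + 3 by omega, show (2 * j + 5) / 2 = j + 2 by omega]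
      rfl

open Nat in
-- The ratio to `(j!)²` grows by `1/(j!(j-1)!)` at each step and stays below 2.341; the added 1
-- makes the estimate inductive.
lemma pathBound_even_le {j : ℕ} (hj : 5 ≤ j) :
    1000 * (pathBound (2 * j) + 1) ≤ 2341 * (j ! * j !) := by
  induction j, hj using Nat.le_induction with
  | base => simp [pathBound, Nat.factorial]
  | succ j hj ih =>
    obtain ⟨i, rfl⟩ : ∃ i, j = i + 5 := ⟨j - 5, by omega⟩
    rw [show 2 * (i + 5 + 1) = (2 * i + 7) + 5 by ring, pathBound,
      show (2 * i + 7 + 6) / 2 = i + 6 by omega, show (2 * i + 7 + 5) / 2 = i + 6 by omega,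
      show 2 * i + 7 + 3 = 2 * (i + 5) by ring, Nat.factorial_succ]
    generalize (i + 5)! = f at *
    generalize pathBound (2 * (i + 5)) = t at *
    have := Nat.mul_le_mul_left ((i + 6) * (i + 6)) ih
    nlinarith

open Nat in
-- The ratio to `(j+1)! j!` is the partial sum of `∑ 1/(i!)² ≈ 2.2796`.
lemma pathBound_odd_le {j : ℕ} (hj : 4 ≤ j) :
    100 * (pathBound (2 * j + 1) + 1) ≤ 228 * ((j + 1)! * j !) := by
  induction j, hj using Nat.le_induction with
  | base => simp [pathBound, Nat.factorial]
  | succ j hj ih =>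
    rw [← bipPaths_succ_self, bipPaths_succ, Nat.add_sub_cancel, bipPaths_succ_self,
      Nat.factorial_succ (j + 1)]
    conv_rhs => rw [Nat.factorial_succ j]
    rw [Nat.factorial_succ j] at ih
    generalize j ! = f at *
    generalize pathBound (2 * j + 1) = t at *
    have := Nat.mul_le_mul_left ((j + 2) * (j + 1)) ih
    nlinarith

open Nat in
lemma le_pathBound_odd (j : ℕ) : (j + 1)! * j ! ≤ pathBound (2 * j + 1) := by
  induction j with
  | zero => simp [pathBound]
  | succ j ih =>
    rw [← bipPaths_succ_self, bipPaths_succ, Nat.add_sub_cancel, bipPaths_succ_self]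
    calc (j + 1 + 1)! * (j + 1)! = (j + 1 + 1) * ((j + 1) * ((j + 1)! * j !)) := by
          rw [Nat.factorial_succ (j + 1)]
          conv_lhs => rw [mul_assoc, Nat.factorial_succ j]
          rw [Nat.factorial_succ j]
          ring
      _ ≤ _ := by
          gcongr
          exact (Nat.mul_le_mul_left _ ih).trans (Nat.le_add_left _ _)

open Nat in
-- The ratio is a partial sum of `∑ 1/(i!(i-1)!)`, which passes 1.59 at `j = 4`.
lemma le_bipPaths_self {j : ℕ} (hj : 4 ≤ j) : 159 * (j ! * j !) ≤ 100 * bipPaths j j := by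
  induction j, hj using Nat.le_induction with
  | base => simp [bipPaths, Nat.factorial]
  | succ j hj ih =>
    rw [bipPaths_succ, Nat.add_sub_cancel, Nat.factorial_succ]
    have := Nat.mul_le_mul_left ((j + 1) * (j + 1)) ih
    nlinarith

lemma le_bipCycles (p q : ℕ) : q * ((q - 1) * bipPaths p (q - 2)) ≤ bipCycles (p + 1) q := by
  rw [bipCycles]
  exact Nat.le_add_left _ _

open Nat in
lemma bound_lt_bipCycles_even {k d : ℕ} (hk : 71 ≤ k) (hd : 5 * d ≤ 4 * k) :
    d * ((d - 1) * pathBound (2 * k - 3)) + 2 * ((k - 1) * ((k - 1 - 1) * pathBound (2 * k - 4))) <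
      bipCycles k k := by
  obtain ⟨j, rfl⟩ : ∃ j, k = j + 2 := ⟨k - 2, by omega⟩
  refine lt_of_lt_of_le ?_ (le_bipCycles _ _)
  simp only [show 2 * (j + 2) - 3 = 2 * j + 1 by omega, show 2 * (j + 2) - 4 = 2 * j by omega,
    show j + 2 - 1 = j + 1 by omega, Nat.add_sub_cancel, bipPaths_succ_self]
  have hE := pathBound_even_le (j := j) (by omega)
  have hO := le_pathBound_odd j
  rw [Nat.factorial_succ, mul_assoc] at hO
  have hjf : 70 * (j ! * j !) ≤ (j + 1) * (j ! * j !) := Nat.mul_le_mul_right _ (by omega)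
  generalize j ! * j ! = f at *
  generalize pathBound (2 * j + 1) = t at *
  generalize pathBound (2 * j) = e at *
  -- Hence the cycles avoiding the vertex cost at most 1/3 of the target, and `16/25 + 1/3 < 1`.
  have h6 : 6 * (e + 1) ≤ t := by omega
  have hdd : 25 * (d * (d - 1)) ≤ 16 * ((j + 2) * (j + 1)) := by
    rcases Nat.eq_zero_or_pos d with rfl | hd0
    · simp
    obtain ⟨c, rfl⟩ : ∃ c, d = c + 1 := ⟨d - 1, by omega⟩
    rw [Nat.add_sub_cancel]
    have : 5 * (c + 1) * (5 * c) ≤ (4 * (j + 2)) * (4 * (j + 1)) :=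
      Nat.mul_le_mul hd (by omega)
    linarith
  have h1 := Nat.mul_le_mul_right t hdd
  have h2 : 12 * ((j + 1) * (j * (e + 1))) ≤ 2 * ((j + 1) * (j * t)) := by
    calc _ = 2 * ((j + 1) * (j * (6 * (e + 1)))) := by ring
      _ ≤ _ := by gcongr
  have h3 : 0 < (j + 1) * t := by
    have : 0 < t := by omega
    positivity
  nlinarith

open Nat in
lemma bound_lt_bipCycles_odd {k d : ℕ} (hk : 70 ≤ k) (hd : 5 * d ≤ 4 * k + 2) :
    d * ((d - 1) * pathBound (2 * k - 2)) + 2 * (k * ((k - 1) * pathBound (2 * k - 3))) <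
      bipCycles (k + 1) k := by
  obtain ⟨j, rfl⟩ : ∃ j, k = j + 2 := ⟨k - 2, by omega⟩
  -- The target is bounded below by the cycles through a vertex of the smaller side, which has
  -- degree `k + 1`.
  rw [bipCycles_comm]
  refine lt_of_lt_of_le ?_ (le_bipCycles _ _)
  simp only [show 2 * (j + 2) - 3 = 2 * j + 1 by omega,
    show 2 * (j + 2) - 2 = 2 * (j + 1) by omega, show j + 2 - 1 = j + 1 by omega,
    show j + 2 + 1 - 2 = j + 1 by omega, Nat.add_sub_cancel]
  have hE := pathBound_even_le (j := j + 1) (by omega)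
  have hO := pathBound_odd_le (j := j) (by omega)
  have hF := le_bipPaths_self (j := j + 1) (by omega)
  have hff : (j + 1) * ((j + 1)! * j !) = (j + 1)! * (j + 1)! := by
    conv_rhs => rw [Nat.factorial_succ j]
    rw [Nat.factorial_succ j]
    ring
  have hf0 : 0 < (j + 1)! * (j + 1)! := Nat.mul_pos (Nat.factorial_pos _) (Nat.factorial_pos _)
  have hO' : 100 * ((j + 1) * pathBound (2 * j + 1)) ≤ 228 * ((j + 1)! * (j + 1)!) := by
    rw [← hff]
    nlinarith
  generalize (j + 1)! * (j + 1)! = f at *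
  generalize pathBound (2 * j + 1) = t at *
  generalize pathBound (2 * (j + 1)) = e at *
  generalize bipPaths (j + 1) (j + 1) = b at *
  have hdd : 25 * (d * (d - 1)) ≤ 16 * ((j + 3) * (j + 2)) := by
    rcases Nat.eq_zero_or_pos d with rfl | hd0
    · simp
    obtain ⟨c, rfl⟩ : ∃ c, d = c + 1 := ⟨d - 1, by omega⟩
    rw [Nat.add_sub_cancel]
    have : 5 * (c + 1) * (5 * c) ≤ (4 * (j + 3)) * (4 * (j + 2)) :=
      Nat.mul_le_mul (by omega) (by omega)
    linarith
  have h1 : 25000 * (d * ((d - 1) * e)) ≤ 16 * 2341 * ((j + 3) * (j + 2) * f) := by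
    calc 25000 * (d * ((d - 1) * e)) = 25 * (d * (d - 1)) * (1000 * e) := by ring
      _ ≤ 16 * ((j + 3) * (j + 2)) * (2341 * f) := Nat.mul_le_mul hdd (by omega)
      _ = _ := by ring
  have h2 : 100 * (2 * ((j + 2) * ((j + 1) * t))) ≤ 456 * ((j + 2) * f) := by
    nlinarith [Nat.mul_le_mul_left (2 * (j + 2)) hO']
  have h3 : 159 * ((j + 3) * (j + 2) * f) ≤ 100 * ((j + 2 + 1) * ((j + 2) * b)) := by
    nlinarith [Nat.mul_le_mul_left ((j + 3) * (j + 2)) hF]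
  -- With `A = (j+3)(j+2)f` and `B = (j+2)f`, the bound is at most `1.4983 A + 4.56 B`, the target
  -- at least `1.59 A`, and `A ≥ 71 B` closes the gap.
  have h4 : 71 * ((j + 2) * f) ≤ (j + 3) * (j + 2) * f := by
    rw [mul_assoc]
    exact Nat.mul_le_mul_right _ (by omega)
  have h5 : 0 < (j + 2) * f := by positivity
  generalize (j + 3) * (j + 2) * f = A at *
  generalize (j + 2) * f = B at *
  omega

/-! ### The non-bipartite case and the theorem -/

variable {V : Type*} [Fintype V] {G : SimpleGraph V}

theorem numCycles_lt_balanced_of_not_colorable {n : ℕ} (hn : 141 ≤ n) (hV : Fintype.card V = n)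
    (hG : G.CliqueFree 3) (hc : ¬ G.Colorable 2) :
    G.numCycles < (balancedCompleteBipartite n).numCycles := by
  classical
  -- Andrásfai–Erdős–Sós with `r = 2`: the threshold `(3r - 4)n/(3r - 1)` is `2n/5`.
  have hmin : G.minDegree ≤ 2 * n / 5 := by
    by_contra hlt
    exact hc (colorable_of_cliqueFree_lt_minDegree (r := 2) hG (by simpa [hV] using hlt))
  have : Nonempty V := Fintype.card_pos_iff.1 (by omega)
  obtain ⟨v, hv⟩ := G.exists_minimal_degree_vertex
  have hd : (G.nbrsIn Finset.univ v).card ≤ 2 * n / 5 := by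
    rw [nbrsIn, ← neighborFinset_eq_filter, card_neighborFinset_eq_degree, ← hv]
    exact hmin
  have h1 := two_mul_numCycles_le hG (m := n - 4) (by omega) hd
  have h2 := two_mul_numCycles_completeBipartiteGraph ((n + 1) / 2) (n / 2)
  rw [balancedCompleteBipartite]
  rcases Nat.even_or_odd' n with ⟨k, rfl | rfl⟩
  · have h3 := bound_lt_bipCycles_even (k := k) (d := 2 * (2 * k) / 5) (by omega) (by omega)
    rw [show 2 * k - 4 + 1 = 2 * k - 3 by omega, show (2 * k - 4 + 3) / 2 = k - 1 by omega] at h1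
    rw [show bipCycles ((2 * k + 1) / 2) (2 * k / 2) = bipCycles k k by congr 1 <;> omega] at h2
    omega
  · have h3 := bound_lt_bipCycles_odd (k := k) (d := 2 * (2 * k + 1) / 5) (by omega) (by omega)
    rw [show 2 * k + 1 - 4 + 1 = 2 * k - 2 by omega,
      show (2 * k + 1 - 4 + 3) / 2 = k by omega,
      show 2 * k + 1 - 4 = 2 * k - 3 by omega] at h1
    rw [show bipCycles ((2 * k + 1 + 1) / 2) ((2 * k + 1) / 2) = bipCycles (k + 1) k by
      congr 1 <;> omega] at h2
    omega

end SimpleGraph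

theorem theorem5p2 (n : ℕ) (hn : 141 ≤ n) :
    Fintype.card (Fin ((n + 1) / 2) ⊕ Fin (n / 2)) = n ∧
    (balancedCompleteBipartite n).CliqueFree 3 ∧
    ∀ {V : Type*} [Fintype V] (G : SimpleGraph V), Fintype.card V = n → G.CliqueFree 3 →
      G.numCycles ≤ (balancedCompleteBipartite n).numCycles ∧
      (G.numCycles = (balancedCompleteBipartite n).numCycles →
        Nonempty (G ≃g balancedCompleteBipartite n)) := by
  refine ⟨by simp; omega, ?_, fun {V} _ G hV hG => ?_⟩
  · refine SimpleGraph.Colorable.cliqueFree (n := 2) ⟨SimpleGraph.Coloring.mk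
      (fun x => if x.isLeft then 0 else 1) ?_⟩ (by norm_num)
    rintro (a | a) (b | b) <;> simp
  · by_cases hc : G.Colorable 2
    · exact SimpleGraph.numCycles_le_balanced_of_colorable (by omega) hV hc
    · have h := SimpleGraph.numCycles_lt_balanced_of_not_colorable hn hV hG hc
      exact ⟨h.le, fun heq => absurd heq h.ne⟩
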